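/- **Setting.** Let $\theta:\mathcal A\to\mathcal A^{\mathcal D}$ be an aperiodic, primitive block substitution on $\mathbb Z^d$ over a finite alphabet: $Q$ is an expansive integer matrix (all eigenvalues have modulus $>1$), $\mathcal D\subset\mathbb Z^d$ is a hyperrectangle and a complete set of representatives of $\mathbb Z^d/Q\mathbb Z^d$. The supertiles are $\theta^0(a)=a$ (at position $0$), $\theta^{n+1}(a)_{Qj+\delta}=\theta(\theta^n(a)_j)_\delta$ for $j$ in the support of $\theta^n(a)$ and $\delta\in\mathcal D$; $\mathbb X_\theta\subseteq\mathcal A^{\mathbb Z^d}$ is the set of configurations all of whose finite patterns occur, up to translation, in some $\theta^k(a)$, $k\ge1$. Primitive means that for some $k$ every $\theta^k(a)$ contains every letter; aperiodic means that no $x\in\mathbb X_\theta$ has a non-zero period. The shift is $(\sigma_n x)_m=x_{m+n}$. Digit substitutions and their shift spaces are defined in the same way for any complete set $\mathcal D$ of representatives. Fix $x^*\in\mathbb X_\theta$. The return module $\mathcal L$ is the subgroup of $\mathbb Z^d$ generated by $\{j : \exists k,\ x^*_{j+k}=x^*_k\}$. Let $\Gamma$ be the height lattice, i.e. the smallest subgroup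 of $\mathbb Z^d$ with $\mathcal L\subseteq\Gamma$ and $\Gamma+Q\mathbb Z^d=\mathbb Z^d$; write $\Gamma=H\mathbb Z^d$ with $H$ an integer matrix, $\det H\neq0$. Let $\mathcal D_\Gamma$ be a fundamental domain for $\Gamma$ in $\mathbb Z^d$, and let $(m)_\Gamma\in\mathcal D_\Gamma$ be the representative of $m$ mod $\Gamma$. Put $\mathcal A_0=\{x^*_\gamma:\gamma\in\Gamma\}$, $X_0=\{x\in\mathbb X_\theta: x_0\in\mathcal A_0\}$, $\Psi_H(x)_n=\sigma_{Hn}(x)|_{\mathcal D_\Gamma}$, and let $\mathbb Y_0=\Psi_H(X_0)\subseteq(\mathcal A^{\mathcal D_\Gamma})^{\mathbb Z^d}$ be the pure base of $\mathbb X_\theta$. For a subshift $\mathbb Y$, the suspension $\mathbb Y\times\mathcal D_\Gamma$ carries the action $$T_m(y,j)=\bigl(\sigma_q(y),(j+m)_\Gamma\bigr),\qquad q=H^{-1}\bigl(j+m-(j+m)_\Gamma\bigr).$$ An extended symmetry with matrix $A\in\mathrm{GL}(d,\mathbb Z)$ of a $\mathbb Z^d$-action $S$ is a self-homeomorphism $\Phi$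 of the space with $\Phi\circ S_n=S_{An}\circ\Phi$ for all $n$. **Proposition.** In this setting let $A\in\mathrm{GL}(d,\mathbb Z)$ satisfy $H^{-1}A=AH^{-1}$. Then $\mathbb Y_0$ is a subshift. Let $\mathbb Y$ be $\mathbb Y_0$ itself, with $\rho=\mathrm{id}$, or $\mathbb Y=\mathbb X_\vartheta$ for a digit substitution $\vartheta$ over a finite alphabet together with a topological conjugacy $\rho:\mathbb X_\vartheta\to\mathbb Y_0$. Then: 1. $\psi:\mathbb Y\times\mathcal D_\Gamma\to\mathbb X_\theta$, $\psi(y,k)=\sigma_k(x)$ with $x\in X_0$, $\Psi_H(x)=\rho(y)$, is a well-defined topological conjugacy from $(\mathbb Y\times\mathcal D_\Gamma,T)$ to $(\mathbb X_\theta,\sigma)$. 2. For every extended symmetry $\Phi$ of $\mathbb Y$ with matrix $A$ and every $i\in\mathcal D_\Gamma$, the map $$\Phi_i(y,j)=\bigl(\sigma_{H^{-1}t}(\Phi(y)),\,(i+Aj)_\Gamma\bigr),\qquad t=(i+Aj)-(i+Aj)_\Gamma,$$ is an extended symmetry of $(\mathbb Y\times\mathcal D_\Gamma,T)$ with matrix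 $A$. Consequently $\Psi=\psi\circ\Phi_i\circ\psi^{-1}$ is an extended symmetry of $\mathbb X_\theta$ with matrix $A$. -/

import Mathlib

/-! Shifts, digit substitutions and height lattices on `ℤ^d`, pure bases and their suspensions. -/

universe u v

/-- Configurations `𝒜^(ℤ^d)`; they carry the product topology, which is the topology of the
shift metric when `𝒜` is discrete. -/
abbrev Config (d : ℕ) (𝒜 : Type*) : Type _ := (Fin d → ℤ) → 𝒜

/-- The shift `σ_n`, with `(σ_n x)_m = x_{m+n}`. -/
def shift {d : ℕ} {𝒜 : Type*} (n : Fin d → ℤ) (x : Config d 𝒜) : Config d 𝒜 :=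
  fun m => x (m + n)

/-- A subshift: a closed shift-invariant set of configurations. -/
def IsSubshift {d : ℕ} {𝒜 : Type*} [TopologicalSpace 𝒜] (X : Set (Config d 𝒜)) : Prop :=
  IsClosed X ∧ ∀ n, ∀ x ∈ X, shift n x ∈ X

/-- A digit substitution: an expansive integer matrix `Q`, a complete set `D` of representatives
of `ℤ^d / Q ℤ^d`, and a map `θ : 𝒜 → 𝒜^D`. -/
structure DigitSubstitution (d : ℕ) (𝒜 : Type*) where
  Q : Matrix (Fin d) (Fin d) ℤ
  expansive : ∀ μ ∈ spectrum ℂ (Q.map (Int.cast : ℤ → ℂ)), 1 < ‖μ‖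
  D : Finset (Fin d → ℤ)
  digits : ∀ m : Fin d → ℤ, ∃! δ, δ ∈ D ∧ ∃ j : Fin d → ℤ, m = Q.mulVec j + δ
  toFun : 𝒜 → D → 𝒜

namespace DigitSubstitution

variable {d : ℕ} {𝒜 : Type*}

/-- The supertile `θ^n(a)`, a pattern given by its graph: `(m, c) ∈ θ.supertile n a` means that `m`
is in the support `D^(n)` and that the letter at `m` is `c`. -/
def supertile (θ : DigitSubstitution d 𝒜) : ℕ → 𝒜 → Set ((Fin d → ℤ) × 𝒜)
  | 0, a => {(0, a)}
  | n + 1, a => {p | ∃ j b, (j, b) ∈ θ.supertile n a ∧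
      ∃ δ : θ.D, p = (θ.Q.mulVec j + (δ : Fin d → ℤ), θ.toFun b δ)}

/-- The pattern `x|_B` is, up to translation, a subpattern of some `θ^k(a)` with `k ≥ 1`. -/
def IsLegal (θ : DigitSubstitution d 𝒜) (B : Finset (Fin d → ℤ)) (x : Config d 𝒜) : Prop :=
  ∃ a : 𝒜, ∃ k : ℕ, 1 ≤ k ∧ ∃ t : Fin d → ℤ, ∀ b ∈ B, (b + t, x b) ∈ θ.supertile k a

/-- The shift space `𝕏_θ`. -/
def shiftSpace (θ : DigitSubstitution d 𝒜) : Set (Config d 𝒜) :=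
  {x | ∀ B : Finset (Fin d → ℤ), θ.IsLegal B x}

/-- A block substitution: the digit set is a hyperrectangle. -/
def IsBlock (θ : DigitSubstitution d 𝒜) : Prop :=
  ∃ a b : Fin d → ℤ, θ.D = Finset.Icc a b

/-- Some power of `θ` maps every letter to a supertile that contains every letter. -/
def IsPrimitive (θ : DigitSubstitution d 𝒜) : Prop :=
  ∃ k : ℕ, ∀ a b : 𝒜, ∃ m, (m, b) ∈ θ.supertile k a

/-- No element of `𝕏_θ` has a non-zero period. -/
def IsAperiodic (θ : DigitSubstitution d 𝒜) : Prop :=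
  ∀ x ∈ θ.shiftSpace, ∀ n : Fin d → ℤ, n ≠ 0 → shift n x ≠ x

end DigitSubstitution

/-- The sublattice `H ℤ^d` of `ℤ^d`. -/
def latticeOf {d : ℕ} (H : Matrix (Fin d) (Fin d) ℤ) : AddSubgroup (Fin d → ℤ) :=
  H.mulVecLin.toAddMonoidHom.range

/-- The set `Ξ` of return times of a configuration. -/
def returnTimes {d : ℕ} {𝒜 : Type*} (x : Config d 𝒜) : Set (Fin d → ℤ) :=
  {j | ∃ k, x (j + k) = x k}

/-- The return module, generated by the return times. -/
def returnModule {d : ℕ} {𝒜 : Type*} (x : Config d 𝒜) : AddSubgroup (Fin d → ℤ) :=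
  AddSubgroup.closure (returnTimes x)

/-- `Γ` is the height lattice of `𝕏_θ`: the smallest lattice that contains the return module
(computed at the reference point `x` of `𝕏_θ`) and is coprime with `Q ℤ^d`. -/
def IsHeightLattice {d : ℕ} {𝒜 : Type*} (θ : DigitSubstitution d 𝒜) (x : Config d 𝒜)
    (Γ : AddSubgroup (Fin d → ℤ)) : Prop :=
  IsLeast {Γ' : AddSubgroup (Fin d → ℤ) | returnModule x ≤ Γ' ∧ Γ' ⊔ latticeOf θ.Q = ⊤} Γ

/-- A finite fundamental domain `𝒟_Γ` for a sublattice `Γ` of `ℤ^d`. -/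
structure FundDomain {d : ℕ} (Γ : AddSubgroup (Fin d → ℤ)) where
  carrier : Finset (Fin d → ℤ)
  exists_unique : ∀ m : Fin d → ℤ, ∃! k, k ∈ carrier ∧ m - k ∈ Γ

/-- `(m)_Γ`, the unique element of the fundamental domain that is congruent to `m` mod `Γ`. -/
noncomputable def FundDomain.red {d : ℕ} {Γ : AddSubgroup (Fin d → ℤ)} (F : FundDomain Γ)
    (m : Fin d → ℤ) : F.carrier :=
  ⟨(F.exists_unique m).choose, (F.exists_unique m).choose_spec.1.1⟩

/-- `H⁻¹ v` for `v ∈ H ℤ^d`, by Cramer's rule: `H⁻¹ v = (det H)⁻¹ adj(H) v`. -/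
def latInv {d : ℕ} (H : Matrix (Fin d) (Fin d) ℤ) (v : Fin d → ℤ) : Fin d → ℤ :=
  fun r => H.adjugate.mulVec v r / H.det

theorem latInv_mulVec {d : ℕ} (H : Matrix (Fin d) (Fin d) ℤ) (hH : H.det ≠ 0) (n : Fin d → ℤ) :
    latInv H (H.mulVec n) = n := by
  funext r
  simp [latInv, Matrix.mulVec_mulVec, Matrix.adjugate_mul, hH]

section PureBase

variable {d : ℕ} {𝒜 ℬ : Type*}

/-- The class `𝒜_k` of the alphabet partition induced by `Γ`: the letters that the reference
point `x₀` shows at the positions of `k + Γ`. -/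
def letterClass (Γ : AddSubgroup (Fin d → ℤ)) (x₀ : Config d 𝒜) (k : Fin d → ℤ) : Set 𝒜 :=
  {a | ∃ j, j - k ∈ Γ ∧ x₀ j = a}

/-- `X_0 = {x ∈ 𝕏_θ : x_0 ∈ 𝒜_0}`. -/
def baseSet (θ : DigitSubstitution d 𝒜) (Γ : AddSubgroup (Fin d → ℤ)) (x₀ : Config d 𝒜) :
    Set (Config d 𝒜) :=
  {x | x ∈ θ.shiftSpace ∧ x 0 ∈ letterClass Γ x₀ 0}

/-- The recoding of a configuration by its `𝒟_Γ`-patterns at the positions of `H ℤ^d`: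
the letter at `n` is the pattern `σ_{Hn}(x)|_{𝒟_Γ}`. -/
def blockMap (H : Matrix (Fin d) (Fin d) ℤ) (F : FundDomain (latticeOf H)) (x : Config d 𝒜) :
    Config d (F.carrier → 𝒜) :=
  fun n k => shift (H.mulVec n) x k

/-- The pure base `𝕐_0`, the image of `X_0` under the recoding. -/
def pureBase (θ : DigitSubstitution d 𝒜) (x₀ : Config d 𝒜) (H : Matrix (Fin d) (Fin d) ℤ)
    (F : FundDomain (latticeOf H)) : Set (Config d (F.carrier → 𝒜)) :=
  blockMap H F '' baseSet θ (latticeOf H) x₀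

/-- The space `Y × 𝒟_Γ`. -/
def suspension {Γ : AddSubgroup (Fin d → ℤ)} (F : FundDomain Γ) (Y : Set (Config d ℬ)) :
    Set (Config d ℬ × F.carrier) :=
  {z | z.1 ∈ Y}

/-- The action `T_m(y, j) = (σ_q(y), (j + m)_Γ)` with `q = H⁻¹(j + m - (j + m)_Γ)`. -/
noncomputable def suspAct (H : Matrix (Fin d) (Fin d) ℤ) (F : FundDomain (latticeOf H))
    (m : Fin d → ℤ) (z : Config d ℬ × F.carrier) : Config d ℬ × F.carrier :=
  (shift (latInv H ((z.2 : Fin d → ℤ) + m - F.red (z.2 + m))) z.1, F.red (z.2 + m))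

/-- `Φ` is a topological conjugacy from `S` with the action `T` to `S'` with the action `T'`
(`S` and `S'` invariant sets). -/
def IsConjugacy {Z Z' : Type*} [TopologicalSpace Z] [TopologicalSpace Z'] {S : Set Z} {S' : Set Z'}
    (T : (Fin d → ℤ) → Z → Z) (T' : (Fin d → ℤ) → Z' → Z') (Φ : S ≃ₜ S') : Prop :=
  ∀ (n : Fin d → ℤ) (z : S) (hz : T n z ∈ S), (Φ ⟨T n z, hz⟩ : Z') = T' n (Φ z)

/-- `Φ` is an extended symmetry with matrix `A` of the `ℤ^d`-action `T` on the invariant set `S`: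
a homeomorphism of `S` with `Φ ∘ T_n = T_{An} ∘ Φ` for all `n`. -/
def IsExtendedSymmetry {Z : Type*} [TopologicalSpace Z] {S : Set Z} (T : (Fin d → ℤ) → Z → Z)
    (A : Matrix.GeneralLinearGroup (Fin d) ℤ) (Φ : S ≃ₜ S) : Prop :=
  ∀ (n : Fin d → ℤ) (z : S) (hz : T n z ∈ S),
    (Φ ⟨T n z, hz⟩ : Z) = T ((A : Matrix (Fin d) (Fin d) ℤ).mulVec n) (Φ z)

/-- The map `Φ_i(y, j) = (σ_{H⁻¹t}(Φ(y)), (i + Aj)_Γ)` with `t = i + Aj - (i + Aj)_Γ`. -/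
noncomputable def liftMap [TopologicalSpace ℬ] (H : Matrix (Fin d) (Fin d) ℤ)
    (F : FundDomain (latticeOf H)) (A : Matrix.GeneralLinearGroup (Fin d) ℤ) (i : F.carrier)
    {Y : Set (Config d ℬ)} (Φ : Y ≃ₜ Y) (z : suspension F Y) : Config d ℬ × F.carrier :=
  let s : Fin d → ℤ := i + (A : Matrix (Fin d) (Fin d) ℤ).mulVec z.1.2
  (shift (latInv H (s - F.red s)) (Φ ⟨z.1.1, z.2⟩), F.red s)

/-- Let `ρ` be a conjugacy from `Y` to `𝕐_0`. The canonical map `ψ(y, k) = σ_k(x)`, where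
`x ∈ X_0` is recoded as `ρ(y)`, is a conjugacy from the suspension `(Y × 𝒟_Γ, T)` to `(𝕏_θ, σ)`,
and for every extended symmetry `Φ` of `Y` with matrix `A` and every `i ∈ 𝒟_Γ` the map `Φ_i` is an
extended symmetry of the suspension with matrix `A`, which `ψ` carries to an extended symmetry
of `𝕏_θ` with matrix `A`. -/
def LiftsToSuspension [TopologicalSpace 𝒜] [TopologicalSpace ℬ] (θ : DigitSubstitution d 𝒜)
    (x₀ : Config d 𝒜) (H : Matrix (Fin d) (Fin d) ℤ) (F : FundDomain (latticeOf H))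
    (A : Matrix.GeneralLinearGroup (Fin d) ℤ) (Y : Set (Config d ℬ))
    (ρ : Y ≃ₜ pureBase θ x₀ H F) : Prop :=
  (∀ n, ∀ z ∈ suspension F Y, suspAct H F n z ∈ suspension F Y) ∧
  ∃ ψ : suspension F Y ≃ₜ θ.shiftSpace,
    (∀ (z : suspension F Y), ∀ x ∈ baseSet θ (latticeOf H) x₀,
      blockMap H F x = ρ ⟨z.1.1, z.2⟩ → (ψ z : Config d 𝒜) = shift z.1.2 x) ∧
    IsConjugacy (suspAct H F) shift ψ ∧
    ∀ Φ : Y ≃ₜ Y, IsExtendedSymmetry shift A Φ → ∀ i : F.carrier,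
      ∃ Φi : suspension F Y ≃ₜ suspension F Y,
        (∀ z, (Φi z : Config d ℬ × F.carrier) = liftMap H F A i Φ z) ∧
        IsExtendedSymmetry (suspAct H F) A Φi ∧
        ∃ Ψ : θ.shiftSpace ≃ₜ θ.shiftSpace,
          IsExtendedSymmetry shift A Ψ ∧ ∀ z, Ψ (ψ z) = ψ (Φi z)

end PureBase

/-! The letters of a point `x` of `𝕏_θ` reveal positions modulo `Γ`. In the reference point, equal
letters lie at positions that differ by a return time, hence by an element of `Γ`. By primitivity
every pair of letters of `x` also occurs in the reference point with the same displacement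
(`IsPrimitive.exists_occurrence`). So there is an offset `t` with `σ_n x ∈ X_0` iff `n + t ∈ Γ`
(`exists_shift_mem_baseSet_iff`). The translates of `X_0` by `𝒟_Γ` therefore partition `𝕏_θ`, and
`X_0` is closed and invariant under `Γ = H ℤ^d`.

The block recoding is a homeomorphism of full shifts that turns `σ_{Hn}` into `σ_n`. Hence `𝕐_0` is
a subshift, and `ψ` is a continuous bijection from a compact space to a Hausdorff one.

Since `A` is invertible over `ℤ` and commutes with `H`, both `A` and `A⁻¹` preserve `Γ`. Thus `j ↦
(i + Aj)_Γ` permutes `𝒟_Γ`, and `Φ_i` is a homeomorphism. Its equivariance is a cocycle identity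
between lattice vectors, checked after applying `H` (`liftMap_suspAct`). -/

/-! ### Supertiles, and recurrence of patterns under primitivity. -/

namespace DigitSubstitution

variable {d : ℕ} {𝒜 : Type*} (θ : DigitSubstitution d 𝒜)

theorem det_Q_ne_zero : θ.Q.det ≠ 0 := by
  intro h
  have h0 : (0 : ℂ) ∈ spectrum ℂ (θ.Q.map (Int.cast : ℤ → ℂ)) := by
    rw [spectrum.zero_mem_iff, Matrix.isUnit_iff_isUnit_det]
    have : (θ.Q.map (Int.cast : ℤ → ℂ)).det = ((θ.Q.det : ℤ) : ℂ) :=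
      ((Int.castRingHom ℂ).map_det θ.Q).symm
    rw [this, h]
    simp
  have := θ.expansive 0 h0
  simp at this
  linarith

theorem mulVec_Q_injective : Function.Injective θ.Q.mulVec :=
  Matrix.mulVec_injective_of_det_ne_zero θ.det_Q_ne_zero

/-- Since `D` is a complete residue system and `Q` is injective, a position has only one expansion
in digits. -/
theorem supertile_letter_unique {n : ℕ} {a : 𝒜} {m : Fin d → ℤ} {c c' : 𝒜}
    (h : (m, c) ∈ θ.supertile n a) (h' : (m, c') ∈ θ.supertile n a) : c = c' := by
  induction n generalizing m c c' with
  | zero =>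
    simp only [supertile, Set.mem_singleton_iff, Prod.mk.injEq] at h h'
    rw [h.2, h'.2]
  | succ n ih =>
    obtain ⟨j, b, hj, δ, e⟩ := h
    obtain ⟨j', b', hj', δ', e'⟩ := h'
    simp only [Prod.mk.injEq] at e e'
    have hδ : δ = δ' := Subtype.ext
      ((θ.digits m).unique ⟨δ.2, j, e.1⟩ ⟨δ'.2, j', e'.1⟩)
    subst hδ
    have hjj : j = j' := θ.mulVec_Q_injective (add_right_cancel (e.1.symm.trans e'.1))
    subst hjj
    rw [e.2, e'.2, ih hj hj']

/-- The definition peels off one substitution step; this splitting cuts a supertile of high level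
into supertiles of level `p`. -/
theorem mem_supertile_add {p q : ℕ} {a : 𝒜} {m : Fin d → ℤ} {c : 𝒜} :
    (m, c) ∈ θ.supertile (q + p) a ↔
      ∃ j b δ, (j, b) ∈ θ.supertile q a ∧ (δ, c) ∈ θ.supertile p b ∧
        m = (θ.Q ^ p).mulVec j + δ := by
  induction p generalizing m c with
  | zero =>
    constructor
    · intro h
      exact ⟨m, c, 0, h, rfl, by simp⟩
    · rintro ⟨j, b, δ, h, h', rfl⟩
      simp only [supertile, Set.mem_singleton_iff, Prod.mk.injEq] at h'
      obtain ⟨rfl, rfl⟩ := h'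
      simpa using h
  | succ p ih =>
    constructor
    · rintro ⟨j', b', h, ε, e⟩
      obtain ⟨j, b, δ, hj, hδ, rfl⟩ := ih.1 h
      simp only [Prod.mk.injEq] at e
      obtain ⟨rfl, rfl⟩ := e
      refine ⟨j, b, θ.Q.mulVec δ + ε, hj, ⟨δ, b', hδ, ε, rfl⟩, ?_⟩
      rw [Matrix.mulVec_add, Matrix.mulVec_mulVec, ← pow_succ', add_assoc]
    · rintro ⟨j, b, _, hj, ⟨δ, b', hδ, ε, e⟩, rfl⟩
      simp only [Prod.mk.injEq] at e
      obtain ⟨rfl, rfl⟩ := e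
      refine ⟨(θ.Q ^ p).mulVec j + δ, b', ih.2 ⟨j, b, δ, hj, hδ, rfl⟩, ε, ?_⟩
      rw [Matrix.mulVec_add, Matrix.mulVec_mulVec, ← pow_succ', add_assoc]

theorem exists_finset_supertile_support (n : ℕ) :
    ∃ S : Finset (Fin d → ℤ), ∀ a m c, (m, c) ∈ θ.supertile n a → m ∈ S := by
  classical
  induction n with
  | zero =>
    refine ⟨{0}, fun a m c h => ?_⟩
    simp only [supertile, Set.mem_singleton_iff, Prod.mk.injEq] at h
    simp [h.1]
  | succ n ih =>
    obtain ⟨S, hS⟩ := ih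
    refine ⟨Finset.image₂ (fun j δ => θ.Q.mulVec j + δ) S θ.D, ?_⟩
    rintro a m c ⟨j, b, hj, δ, e⟩
    simp only [Prod.mk.injEq] at e
    exact Finset.mem_image₂.2 ⟨j, hS _ _ _ hj, δ, δ.2, e.1.symm⟩

/-- A pattern of sufficiently many cells is not contained in a supertile of low level. -/
theorem exists_le_level [Infinite (Fin d → ℤ)] (N : ℕ) :
    ∃ C : ℕ, ∀ (B : Finset (Fin d → ℤ)) (x : Config d 𝒜) (t : Fin d → ℤ) (a : 𝒜) (n : ℕ),
      C ≤ B.card → (∀ b ∈ B, (b + t, x b) ∈ θ.supertile n a) → N ≤ n := by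
  classical
  choose S hS using θ.exists_finset_supertile_support
  -- One more cell than the support bounds of all levels below `N` allow.
  refine ⟨((Finset.range N).sup fun n => (S n).card) + 1, fun B x t a n hB h => ?_⟩
  by_contra! hn
  have h1 : (S n).card ≤ (Finset.range N).sup fun n => (S n).card :=
    Finset.le_sup (f := fun n => (S n).card) (Finset.mem_range.2 hn)
  have h2 : B.card ≤ (S n).card :=
    Finset.card_le_card_of_injOn (· + t) (fun b hb => hS _ _ _ _ (h b hb))
      (add_left_injective t).injOn
  omega

/-- Every finite pattern of an element of `𝕏_θ` occurs in every element of `𝕏_θ`. -/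
theorem IsPrimitive.exists_occurrence {θ : DigitSubstitution d 𝒜} (hθ : θ.IsPrimitive)
    {x y : Config d 𝒜} (hx : x ∈ θ.shiftSpace) (hy : y ∈ θ.shiftSpace)
    (B : Finset (Fin d → ℤ)) : ∃ t : Fin d → ℤ, ∀ b ∈ B, x b = y (b + t) := by
  classical
  rcases Nat.eq_zero_or_pos d with rfl | hd
  -- In dimension 0 a supertile has a single cell, so primitivity leaves only one letter.
  · obtain ⟨k, hk⟩ := hθ
    refine ⟨0, fun b _ => ?_⟩
    obtain ⟨m, hm⟩ := hk (x b) (x b)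
    obtain ⟨m', hm'⟩ := hk (x b) (y (b + 0))
    rw [Subsingleton.elim m' m] at hm'
    exact θ.supertile_letter_unique hm hm'
  have : Nonempty (Fin d) := ⟨⟨0, hd⟩⟩
  obtain ⟨n, hn⟩ := hθ
  obtain ⟨a, k, -, t, ht⟩ := hx B
  obtain ⟨S, hS⟩ := θ.exists_finset_supertile_support (n + k)
  obtain ⟨C, hC⟩ := θ.exists_le_level (n + k)
  -- The window has enough cells to force level at least `n + k`. It also contains `S - S`, so it
  -- covers the whole supertile of level `n + k` around the origin.
  obtain ⟨W, hW, hWC⟩ := Infinite.exists_superset_card_eq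
    (insert 0 (Finset.image₂ (· - ·) S S))
    (max C (insert 0 (Finset.image₂ (· - ·) S S)).card) (le_max_right _ _)
  obtain ⟨c, l, -, s, hs⟩ := hy W
  obtain ⟨q, rfl⟩ := Nat.exists_eq_add_of_le' (hC W y s c l (hWC ▸ le_max_left _ _) hs)
  obtain ⟨j, b, δ, hj, hδ, e⟩ :=
    θ.mem_supertile_add.1 (hs 0 (hW (Finset.mem_insert_self _ _)))
  -- The supertile `θ^n(b)` contains `a`, so `θ^(n+k)(b)` contains `θ^k(a)` and with it the pattern
  -- of `x`.
  obtain ⟨v, hv⟩ := hn b a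
  refine ⟨(θ.Q ^ k).mulVec v + t - δ, fun β hβ => ?_⟩
  have h1 : ((θ.Q ^ k).mulVec v + (β + t), x β) ∈ θ.supertile (n + k) b :=
    θ.mem_supertile_add.2 ⟨v, a, β + t, hv, ht β hβ, rfl⟩
  have h2 := θ.mem_supertile_add.2 ⟨j, b, _, hj, h1, rfl⟩
  have h3 : β + ((θ.Q ^ k).mulVec v + t - δ) ∈ W := by
    refine hW (Finset.mem_insert_of_mem (Finset.mem_image₂.2
      ⟨_, hS _ _ _ h1, δ, hS _ _ _ hδ, ?_⟩))
    abel
  refine θ.supertile_letter_unique h2 ?_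
  convert hs _ h3 using 2
  rw [zero_add] at e
  rw [e]
  abel

theorem shift_mem_shiftSpace {x : Config d 𝒜} (hx : x ∈ θ.shiftSpace) (n : Fin d → ℤ) :
    shift n x ∈ θ.shiftSpace := by
  classical
  intro B
  obtain ⟨a, k, hk, t, ht⟩ := hx (B.image (· + n))
  refine ⟨a, k, hk, n + t, fun b hb => ?_⟩
  rw [← add_assoc]
  exact ht _ (Finset.mem_image_of_mem _ hb)

theorem isClosed_shiftSpace [TopologicalSpace 𝒜] [DiscreteTopology 𝒜] :
    IsClosed θ.shiftSpace := by
  have : θ.shiftSpace = ⋂ B : Finset (Fin d → ℤ),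
      (fun (x : Config d 𝒜) (b : B) => x b) ⁻¹'
        {p | ∃ a : 𝒜, ∃ k : ℕ, 1 ≤ k ∧ ∃ t : Fin d → ℤ,
          ∀ b : B, ((b : Fin d → ℤ) + t, p b) ∈ θ.supertile k a} := by
    ext x
    simp [shiftSpace, IsLegal]
  rw [this]
  -- Legality on `B` depends on finitely many coordinates, and the finite product over `B` is
  -- discrete.
  exact isClosed_iInter fun B =>
    (isClosed_discrete _).preimage (continuous_pi fun b => continuous_apply _)

end DigitSubstitution

/-! ### The shift action. -/

section Shift

variable {d : ℕ} {𝒜 : Type*}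

theorem shift_shift (m n : Fin d → ℤ) (x : Config d 𝒜) :
    shift m (shift n x) = shift (m + n) x := by
  funext k
  simp [shift, add_assoc]

@[simp]
theorem shift_zero (x : Config d 𝒜) : shift 0 x = x := by
  funext k
  simp [shift]

theorem shift_injective (n : Fin d → ℤ) :
    Function.Injective (shift n : Config d 𝒜 → Config d 𝒜) := by
  intro x y h
  simpa [shift_shift] using congrArg (shift (-n)) h

/-- The shift is jointly continuous in the configuration and a discrete parameter. -/
theorem continuous_shift_of_discrete [TopologicalSpace 𝒜] {ι : Type*} [TopologicalSpace ι]
    [DiscreteTopology ι] (f : ι → Fin d → ℤ) :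
    Continuous fun z : Config d 𝒜 × ι => shift (f z.2) z.1 := by
  refine continuous_prod_of_discrete_right.2 fun i => ?_
  exact continuous_pi fun m => continuous_apply (m + f i)

end Shift

/-! ### Reduction modulo the lattice, and matrices commuting with `H`. -/

section Lattice

variable {d : ℕ} {H : Matrix (Fin d) (Fin d) ℤ}

theorem mulVec_mem_latticeOf (n : Fin d → ℤ) : H.mulVec n ∈ latticeOf H := ⟨n, rfl⟩

theorem mulVec_latInv (hH : H.det ≠ 0) {v : Fin d → ℤ} (hv : v ∈ latticeOf H) :
    H.mulVec (latInv H v) = v := by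
  obtain ⟨n, rfl⟩ := hv
  exact congrArg H.mulVec (latInv_mulVec H hH n)

theorem FundDomain.sub_red_mem {Γ : AddSubgroup (Fin d → ℤ)} (F : FundDomain Γ)
    (m : Fin d → ℤ) : m - F.red m ∈ Γ :=
  (F.exists_unique m).choose_spec.1.2

theorem FundDomain.red_eq_of_sub_mem {Γ : AddSubgroup (Fin d → ℤ)} (F : FundDomain Γ)
    {m : Fin d → ℤ} {k : F.carrier} (h : m - k ∈ Γ) : F.red m = k :=
  Subtype.ext ((F.exists_unique m).unique ⟨(F.red m).2, F.sub_red_mem m⟩ ⟨k.2, h⟩)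

theorem FundDomain.red_eq_red_iff {Γ : AddSubgroup (Fin d → ℤ)} (F : FundDomain Γ)
    {m n : Fin d → ℤ} : F.red m = F.red n ↔ m - n ∈ Γ := by
  constructor
  · intro h
    have := Γ.sub_mem (F.sub_red_mem m) (F.sub_red_mem n)
    rw [h] at this
    simpa using this
  · intro h
    refine F.red_eq_of_sub_mem ?_
    have := Γ.add_mem h (F.sub_red_mem n)
    simpa using this

theorem commute_of_inv_mul_eq (hH : H.det ≠ 0) {A : Matrix (Fin d) (Fin d) ℤ}
    (hA : (H.map (Int.cast : ℤ → ℚ))⁻¹ * A.map (Int.cast : ℤ → ℚ) =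
      A.map (Int.cast : ℤ → ℚ) * (H.map (Int.cast : ℤ → ℚ))⁻¹) : H * A = A * H := by
  have hdet : IsUnit (H.map (Int.cast : ℤ → ℚ)).det := by
    have : (H.map (Int.cast : ℤ → ℚ)).det = ((H.det : ℤ) : ℚ) :=
      ((Int.castRingHom ℚ).map_det H).symm
    rw [this]
    exact (Int.cast_ne_zero.2 hH).isUnit
  set K := H.map (Int.cast : ℤ → ℚ)
  set L := A.map (Int.cast : ℤ → ℚ)
  have h : K * L = L * K := by
    calc K * L = K * (L * K⁻¹) * K := by
          rw [mul_assoc, Matrix.nonsing_inv_mul_cancel_right _ _ hdet]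
      _ = L * K := by rw [← hA, ← mul_assoc, Matrix.mul_nonsing_inv _ hdet, one_mul]
  have hinj : Function.Injective
      (fun M : Matrix (Fin d) (Fin d) ℤ => M.map (Int.cast : ℤ → ℚ)) :=
    Matrix.map_injective Int.cast_injective
  refine hinj ?_
  change (H * A).map (Int.castRingHom ℚ) = (A * H).map (Int.castRingHom ℚ)
  rw [Matrix.map_mul, Matrix.map_mul]
  exact h

/-- The integer inverse `A⁻¹` commutes with `H` as well, which gives the converse direction. -/
theorem mulVec_mem_latticeOf_iff {A : Matrix.GeneralLinearGroup (Fin d) ℤ}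
    (hA : H * (A : Matrix (Fin d) (Fin d) ℤ) = (A : Matrix (Fin d) (Fin d) ℤ) * H)
    {v : Fin d → ℤ} :
    (A : Matrix (Fin d) (Fin d) ℤ).mulVec v ∈ latticeOf H ↔ v ∈ latticeOf H := by
  have hA' : H * (A⁻¹).1 = (A⁻¹).1 * H := (Commute.units_inv_right (u := A) hA).eq
  have key : ∀ {B : Matrix (Fin d) (Fin d) ℤ} {w : Fin d → ℤ}, H * B = B * H →
      w ∈ latticeOf H → B.mulVec w ∈ latticeOf H := by
    rintro B _ hB ⟨n, rfl⟩
    refine ⟨B.mulVec n, ?_⟩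
    change H.mulVec (B.mulVec n) = B.mulVec (H.mulVec n)
    rw [Matrix.mulVec_mulVec, Matrix.mulVec_mulVec, hB]
  refine ⟨fun h => ?_, key hA⟩
  have := key hA' h
  rwa [Matrix.mulVec_mulVec, Units.inv_mul, Matrix.one_mulVec] at this

end Lattice

/-! ### Recoding by blocks over the fundamental domain. -/

section Recoding

variable {d : ℕ} {𝒜 : Type*} {H : Matrix (Fin d) (Fin d) ℤ} (F : FundDomain (latticeOf H))

/-- The recoding by `𝒟_Γ`-patterns is a homeomorphism of the full shifts. -/
noncomputable def blockHomeomorph [TopologicalSpace 𝒜] (hH : H.det ≠ 0) :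
    Config d 𝒜 ≃ₜ Config d (F.carrier → 𝒜) where
  toFun := blockMap H F
  -- Write `m = Hn + k` with `k = (m)_Γ`; the letter at `m` is entry `k` of the block at `n`.
  invFun y := fun m => y (latInv H (m - F.red m)) (F.red m)
  left_inv x := by
    funext m
    simp only [blockMap, shift]
    rw [mulVec_latInv hH (F.sub_red_mem m)]
    congr 1
    abel
  right_inv y := by
    funext n k
    have hk : F.red ((k : Fin d → ℤ) + H.mulVec n) = k :=
      F.red_eq_of_sub_mem (by simpa using mulVec_mem_latticeOf n)
    simp only [blockMap, shift]
    rw [hk, add_sub_cancel_left, latInv_mulVec H hH]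
  continuous_toFun := continuous_pi fun n => continuous_pi fun k => continuous_apply _
  continuous_invFun := continuous_pi fun m =>
    (continuous_apply _).comp (continuous_apply _)

theorem blockMap_shift_mulVec (n : Fin d → ℤ) (x : Config d 𝒜) :
    blockMap H F (shift (H.mulVec n) x) = shift n (blockMap H F x) := by
  funext m k
  simp only [blockMap, shift, Matrix.mulVec_add, add_assoc]

end Recoding

/-! ### Positions modulo `Γ`, and the pure base as a subshift. -/

section Base

variable {d : ℕ} {𝒜 : Type*} {θ : DigitSubstitution d 𝒜} {x₀ : Config d 𝒜}
  {Γ : AddSubgroup (Fin d → ℤ)}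

/-- The position of an element of `𝕏_θ` modulo `Γ` can be read off from its letters: relative to
some translation vector `t`, the letter at `m` belongs to `𝒜_k` exactly when `m + t ∈ k + Γ`. -/
theorem exists_shift_mem_baseSet_iff (hθ : θ.IsPrimitive) (hx₀ : x₀ ∈ θ.shiftSpace)
    (hΓ : returnModule x₀ ≤ Γ) {x : Config d 𝒜} (hx : x ∈ θ.shiftSpace) :
    ∃ t : Fin d → ℤ, ∀ n, shift n x ∈ baseSet θ Γ x₀ ↔ n + t ∈ Γ := by
  classical
  have hret : ∀ {j k}, x₀ j = x₀ k → j - k ∈ Γ := fun {j k} h =>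
    hΓ (AddSubgroup.subset_closure ⟨k, by simpa using h⟩)
  obtain ⟨t, ht⟩ := hθ.exists_occurrence hx hx₀ {0}
  have ht0 : x 0 = x₀ t := by simpa using ht 0 (by simp)
  refine ⟨t, fun n => ?_⟩
  -- The occurrence `s` depends on `n`, but the letter at 0 forces `s ≡ t` mod `Γ`, so one offset
  -- serves all `n`.
  obtain ⟨s, hs⟩ := hθ.exists_occurrence hx hx₀ {0, n}
  have hs0 : x 0 = x₀ s := by simpa using hs 0 (by simp)
  have hsn : x n = x₀ (n + s) := hs n (by simp)
  have hst : s - t ∈ Γ := hret (hs0.symm.trans ht0)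
  have hns : n + t ∈ Γ ↔ n + s ∈ Γ := by
    rw [← Γ.add_mem_cancel_right hst]
    rw [show n + t + (s - t) = n + s by abel]
  rw [hns]
  simp only [baseSet, letterClass, Set.mem_ofPred_eq, θ.shift_mem_shiftSpace hx n, true_and, shift,
    zero_add, sub_zero]
  constructor
  · rintro ⟨j, hj, e⟩
    have := Γ.sub_mem hj (hret (e.trans hsn))
    simpa using this
  · exact fun h => ⟨n + s, h, hsn.symm⟩

theorem shift_mem_baseSet_iff (hθ : θ.IsPrimitive) (hx₀ : x₀ ∈ θ.shiftSpace)
    (hΓ : returnModule x₀ ≤ Γ) {x : Config d 𝒜} (hx : x ∈ baseSet θ Γ x₀) (n : Fin d → ℤ) :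
    shift n x ∈ baseSet θ Γ x₀ ↔ n ∈ Γ := by
  obtain ⟨t, ht⟩ := exists_shift_mem_baseSet_iff hθ hx₀ hΓ hx.1
  have h0 : t ∈ Γ := by simpa using (ht 0).1 (by simpa using hx)
  rw [ht, Γ.add_mem_cancel_right h0]

theorem isClosed_baseSet [TopologicalSpace 𝒜] [DiscreteTopology 𝒜] :
    IsClosed (baseSet θ Γ x₀) :=
  θ.isClosed_shiftSpace.inter ((isClosed_discrete (letterClass Γ x₀ 0)).preimage
    (continuous_apply (A := fun _ : Fin d → ℤ => 𝒜) 0))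

theorem isSubshift_pureBase [TopologicalSpace 𝒜] [DiscreteTopology 𝒜]
    {H : Matrix (Fin d) (Fin d) ℤ} (hH : H.det ≠ 0) (F : FundDomain (latticeOf H))
    (hθ : θ.IsPrimitive) (hx₀ : x₀ ∈ θ.shiftSpace) (hΓ : returnModule x₀ ≤ latticeOf H) :
    IsSubshift (pureBase θ x₀ H F) := by
  refine ⟨(blockHomeomorph F hH).isClosedMap _ isClosed_baseSet, ?_⟩
  rintro n _ ⟨x, hx, rfl⟩
  exact ⟨shift (H.mulVec n) x,
    (shift_mem_baseSet_iff hθ hx₀ hΓ hx _).2 (mulVec_mem_latticeOf n),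
    blockMap_shift_mulVec F n x⟩

end Base

/-! ### The lifted maps `Φ_i` on the suspension. -/

section Suspension

variable {d : ℕ} {ℬ : Type*} {H : Matrix (Fin d) (Fin d) ℤ} (F : FundDomain (latticeOf H))
  {Y : Set (Config d ℬ)}

theorem suspAct_mem_suspension (hY : ∀ n, ∀ y ∈ Y, shift n y ∈ Y) (n : Fin d → ℤ)
    {z : Config d ℬ × F.carrier} (hz : z ∈ suspension F Y) :
    suspAct H F n z ∈ suspension F Y :=
  hY _ _ hz

theorem isCompact_suspension [TopologicalSpace ℬ] (hY : IsCompact Y) :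
    IsCompact (suspension F Y) := by
  have : suspension F Y = Y ×ˢ (Set.univ : Set F.carrier) := by
    ext z
    simp [suspension]
  rw [this]
  exact hY.prod isCompact_univ

variable {A : Matrix.GeneralLinearGroup (Fin d) ℤ} [TopologicalSpace ℬ]

theorem liftMap_mem_suspension (hY : ∀ n, ∀ y ∈ Y, shift n y ∈ Y) (i : F.carrier)
    (Φ : Y ≃ₜ Y) (z : suspension F Y) : liftMap H F A i Φ z ∈ suspension F Y :=
  hY _ _ (Φ _).2

theorem continuous_liftMap (i : F.carrier) (Φ : Y ≃ₜ Y) : Continuous (liftMap H F A i Φ) := by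
  have hj : Continuous fun z : suspension F Y => z.1.2 :=
    continuous_snd.comp continuous_subtype_val
  have hy : Continuous fun z : suspension F Y => ((Φ ⟨z.1.1, z.2⟩ : Y) : Config d ℬ) :=
    continuous_subtype_val.comp (Φ.continuous.comp
      ((continuous_fst.comp continuous_subtype_val).subtype_mk _))
  refine Continuous.prodMk ?_ ?_
  · exact (continuous_shift_of_discrete (fun j : F.carrier =>
      latInv H (i + (A : Matrix (Fin d) (Fin d) ℤ).mulVec j -
        F.red (i + (A : Matrix (Fin d) (Fin d) ℤ).mulVec j)))).comp (hy.prodMk hj)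
  · exact (continuous_of_discreteTopology (f := fun j : F.carrier =>
      F.red (i + (A : Matrix (Fin d) (Fin d) ℤ).mulVec j))).comp hj

theorem liftMap_injective
    (hA : H * (A : Matrix (Fin d) (Fin d) ℤ) = (A : Matrix (Fin d) (Fin d) ℤ) * H)
    (i : F.carrier) (Φ : Y ≃ₜ Y) : Function.Injective (liftMap H F A i Φ) := by
  rintro ⟨⟨y, j⟩, hy⟩ ⟨⟨y', j'⟩, hy'⟩ h
  simp only [liftMap, Prod.mk.injEq] at h
  obtain ⟨h1, h2⟩ := h
  have hj : j = j' := by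
    rw [F.red_eq_red_iff, add_sub_add_left_eq_sub, ← Matrix.mulVec_sub,
      mulVec_mem_latticeOf_iff hA] at h2
    rw [← F.red_eq_of_sub_mem h2]
    exact (F.red_eq_of_sub_mem (by simp)).symm
  subst hj
  have hyy : y = y' := congrArg Subtype.val (Φ.injective (Subtype.ext (shift_injective _ h1)))
  subst hyy
  rfl

theorem exists_liftMap_eq (hY : ∀ n, ∀ y ∈ Y, shift n y ∈ Y)
    (hA : H * (A : Matrix (Fin d) (Fin d) ℤ) = (A : Matrix (Fin d) (Fin d) ℤ) * H)
    (i : F.carrier) (Φ : Y ≃ₜ Y) {w : Config d ℬ × F.carrier} (hw : w ∈ suspension F Y) :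
    ∃ z, liftMap H F A i Φ z = w := by
  obtain ⟨w, l⟩ := w
  -- Solves `i + Aj ≡ l` mod `Γ`.
  set j : F.carrier :=
    F.red ((A⁻¹).1.mulVec ((l : Fin d → ℤ) - i)) with hj
  set s : Fin d → ℤ := i + (A : Matrix (Fin d) (Fin d) ℤ).mulVec j with hs
  have hl : F.red s = l := by
    refine F.red_eq_of_sub_mem ?_
    have h := neg_mem ((mulVec_mem_latticeOf_iff hA).2
      (F.sub_red_mem ((A⁻¹).1.mulVec ((l : Fin d → ℤ) - i))))
    rw [← hj, Matrix.mulVec_sub, Matrix.mulVec_mulVec, Units.mul_inv, Matrix.one_mulVec] at h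
    convert h using 1
    rw [hs]
    abel
  set q := latInv H (s - F.red s) with hq
  have hw' : shift (-q) w ∈ Y := hY _ _ hw
  refine ⟨⟨((Φ.symm ⟨_, hw'⟩ : Y), j), (Φ.symm ⟨_, hw'⟩).2⟩, ?_⟩
  have h1 : shift q (Φ (Φ.symm ⟨_, hw'⟩) : Config d ℬ) = w := by
    rw [Homeomorph.apply_symm_apply, shift_shift, add_neg_cancel, shift_zero]
  exact Prod.ext h1 hl

/-- The map `Φ_i` as a self-homeomorphism of the suspension. -/
theorem exists_liftHomeomorph [T2Space ℬ] (hYc : IsCompact Y)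
    (hY : ∀ n, ∀ y ∈ Y, shift n y ∈ Y)
    (hA : H * (A : Matrix (Fin d) (Fin d) ℤ) = (A : Matrix (Fin d) (Fin d) ℤ) * H)
    (i : F.carrier) (Φ : Y ≃ₜ Y) :
    ∃ Φi : suspension F Y ≃ₜ suspension F Y,
      ∀ z, (Φi z : Config d ℬ × F.carrier) = liftMap H F A i Φ z := by
  have : CompactSpace (suspension F Y) :=
    isCompact_iff_compactSpace.1 (isCompact_suspension F hYc)
  let f : suspension F Y → suspension F Y := fun z => 
    ⟨liftMap H F A i Φ z, liftMap_mem_suspension F hY i Φ z⟩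
  have hf : Continuous f := (continuous_liftMap (A := A) F i Φ).subtype_mk _
  have hbij : Function.Bijective f := by
    refine ⟨fun z z' h => liftMap_injective F hA i Φ (congrArg Subtype.val h), fun w => ?_⟩
    obtain ⟨z, hz⟩ := exists_liftMap_eq F hY hA i Φ w.2
    exact ⟨z, Subtype.ext hz⟩
  exact ⟨Continuous.homeoOfEquivCompactToT2 (f := Equiv.ofBijective f hbij) hf, fun z => rfl⟩

theorem liftMap_suspAct (hH : H.det ≠ 0) (hY : ∀ n, ∀ y ∈ Y, shift n y ∈ Y)
    (hA : H * (A : Matrix (Fin d) (Fin d) ℤ) = (A : Matrix (Fin d) (Fin d) ℤ) * H)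
    (i : F.carrier) {Φ : Y ≃ₜ Y} (hΦ : IsExtendedSymmetry shift A Φ) (m : Fin d → ℤ)
    (z : suspension F Y) (hz : suspAct H F m z.1 ∈ suspension F Y) :
    liftMap H F A i Φ ⟨suspAct H F m z.1, hz⟩ =
      suspAct H F ((A : Matrix (Fin d) (Fin d) ℤ).mulVec m) (liftMap H F A i Φ z) := by
  obtain ⟨⟨y, j⟩, hy⟩ := z
  simp only [suspAct, liftMap]
  rw [hΦ _ ⟨y, hy⟩ (hY _ _ hy), shift_shift, shift_shift]
  set B : Matrix (Fin d) (Fin d) ℤ := (A : Matrix (Fin d) (Fin d) ℤ)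
  set j' := F.red ((j : Fin d → ℤ) + m) with hj'
  have hjm : (j : Fin d → ℤ) + m - j' ∈ latticeOf H := F.sub_red_mem _
  have hred : F.red ((i : Fin d → ℤ) + B.mulVec j') =
      F.red ((F.red ((i : Fin d → ℤ) + B.mulVec j) : Fin d → ℤ) + B.mulVec m) := by
    rw [F.red_eq_red_iff]
    have h1 := (latticeOf H).sub_mem (F.sub_red_mem ((i : Fin d → ℤ) + B.mulVec j))
      ((mulVec_mem_latticeOf_iff hA).2 hjm)
    convert h1 using 1
    rw [Matrix.mulVec_sub, Matrix.mulVec_add]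
    abel
  -- Cocycle identity: after applying `H`, both sides equal `i + A(j + m)` minus its common
  -- representative from `hred`.
  have hvec : latInv H ((i : Fin d → ℤ) + B.mulVec j' - F.red ((i : Fin d → ℤ) + B.mulVec j')) +
        B.mulVec (latInv H ((j : Fin d → ℤ) + m - j')) =
      latInv H ((F.red ((i : Fin d → ℤ) + B.mulVec j) : Fin d → ℤ) + B.mulVec m -
          F.red ((F.red ((i : Fin d → ℤ) + B.mulVec j) : Fin d → ℤ) + B.mulVec m)) +
        latInv H ((i : Fin d → ℤ) + B.mulVec j - F.red ((i : Fin d → ℤ) + B.mulVec j)) := by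
    refine Matrix.mulVec_injective_of_det_ne_zero hH ?_
    rw [Matrix.mulVec_add, Matrix.mulVec_add, Matrix.mulVec_mulVec, hA, ← Matrix.mulVec_mulVec,
      mulVec_latInv hH (F.sub_red_mem _), mulVec_latInv hH hjm,
      mulVec_latInv hH (F.sub_red_mem _), mulVec_latInv hH (F.sub_red_mem _), ← hred,
      Matrix.mulVec_sub, Matrix.mulVec_add]
    abel
  rw [hvec, hred]

end Suspension

/-! ### The conjugacy `ψ` and transport of extended symmetries. -/

section Lifting

variable {d : ℕ} {𝒜 ℬ : Type*} {θ : DigitSubstitution d 𝒜} {x₀ : Config d 𝒜}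
  {H : Matrix (Fin d) (Fin d) ℤ} {F : FundDomain (latticeOf H)}
  [TopologicalSpace 𝒜] [TopologicalSpace ℬ]

/-- The canonical map `ψ` from the suspension to `𝕏_θ` is a homeomorphism. -/
theorem exists_suspension_homeomorph [Finite 𝒜] [DiscreteTopology 𝒜]
    (hH : H.det ≠ 0) (hθ : θ.IsPrimitive) (hx₀ : x₀ ∈ θ.shiftSpace)
    (hΓ : returnModule x₀ ≤ latticeOf H) {Y : Set (Config d ℬ)} (hYc : IsCompact Y)
    (ρ : Y ≃ₜ pureBase θ x₀ H F) :
    ∃ ψ : suspension F Y ≃ₜ θ.shiftSpace, ∀ (z : suspension F Y),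
      ∀ x ∈ baseSet θ (latticeOf H) x₀,
        blockMap H F x = ρ ⟨z.1.1, z.2⟩ → (ψ z : Config d 𝒜) = shift z.1.2 x := by
  have : CompactSpace (suspension F Y) :=
    isCompact_iff_compactSpace.1 (isCompact_suspension F hYc)
  let R : Config d 𝒜 ≃ₜ Config d (F.carrier → 𝒜) := blockHomeomorph F hH
  let g : suspension F Y → Config d 𝒜 := fun z => R.symm (ρ ⟨z.1.1, z.2⟩)
  have hR : ∀ x, R x = blockMap H F x := fun _ => rfl
  have hg : Continuous g := R.symm.continuous.comp (continuous_subtype_val.comp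
    (ρ.continuous.comp ((continuous_fst.comp continuous_subtype_val).subtype_mk _)))
  have hgx : ∀ z x, blockMap H F x = ρ ⟨z.1.1, z.2⟩ → g z = x := by
    intro z x h
    change R.symm _ = x
    rw [← h, ← hR, R.symm_apply_apply]
  have hgb : ∀ z, g z ∈ baseSet θ (latticeOf H) x₀ := by
    intro z
    obtain ⟨x, hx, e⟩ := (ρ ⟨z.1.1, z.2⟩).2
    rwa [hgx z x e]
  let f : suspension F Y → θ.shiftSpace := fun z =>
    ⟨shift z.1.2 (g z), θ.shift_mem_shiftSpace (hgb z).1 _⟩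
  have hf : Continuous f :=
    ((continuous_shift_of_discrete (fun j : F.carrier => (j : Fin d → ℤ))).comp
      (hg.prodMk (continuous_snd.comp continuous_subtype_val))).subtype_mk _
  have hbij : Function.Bijective f := by
    constructor
    · intro z z' h
      have h1 : shift z.1.2 (g z) = shift z'.1.2 (g z') := congrArg Subtype.val h
      have h2 : shift ((z.1.2 : Fin d → ℤ) - (z'.1.2 : Fin d → ℤ)) (g z) = g z' := by
        have := congrArg (shift (-(z'.1.2 : Fin d → ℤ))) h1
        rw [shift_shift, shift_shift, neg_add_cancel, shift_zero] at this
        rwa [sub_eq_neg_add]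
      have h3 : (z.1.2 : Fin d → ℤ) - (z'.1.2 : Fin d → ℤ) ∈ latticeOf H := by
        rw [← shift_mem_baseSet_iff hθ hx₀ hΓ (hgb z), h2]
        exact hgb z'
      have h4 : z.1.2 = z'.1.2 := by
        rw [← F.red_eq_of_sub_mem h3]
        exact (F.red_eq_of_sub_mem (by simp)).symm
      rw [h4, sub_self, shift_zero] at h2
      have h5 := ρ.injective (Subtype.ext (R.symm.injective h2))
      exact Subtype.ext (Prod.ext (congrArg Subtype.val h5) h4)
    · rintro ⟨x, hx⟩
      obtain ⟨t, ht⟩ := exists_shift_mem_baseSet_iff hθ hx₀ hΓ hx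
      -- The choice makes `t - k ∈ Γ`, so that `σ_{-k} x` lies in `X_0`.
      set k : F.carrier := F.red t
      have hk : shift (-(k : Fin d → ℤ)) x ∈ baseSet θ (latticeOf H) x₀ := by
        rw [ht, ← sub_eq_neg_add]
        exact F.sub_red_mem t
      let y : Y := ρ.symm ⟨_, Set.mem_image_of_mem (blockMap H F) hk⟩
      refine ⟨⟨(y.1, k), y.2⟩, Subtype.ext ?_⟩
      change shift (k : Fin d → ℤ) (g ⟨(y.1, k), y.2⟩) = x
      have hy : blockMap H F (shift (-(k : Fin d → ℤ)) x) = ρ y := by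
        rw [Homeomorph.apply_symm_apply]
      rw [hgx _ _ hy, shift_shift, add_neg_cancel,
        shift_zero]
  refine ⟨Continuous.homeoOfEquivCompactToT2 (f := Equiv.ofBijective f hbij) hf, ?_⟩
  intro z x _ h
  change shift z.1.2 (g z) = _
  rw [hgx z x h]

theorem isConjugacy_suspension (hH : H.det ≠ 0) (hθ : θ.IsPrimitive) (hx₀ : x₀ ∈ θ.shiftSpace)
    (hΓ : returnModule x₀ ≤ latticeOf H) {Y : Set (Config d ℬ)}
    {ρ : Y ≃ₜ pureBase θ x₀ H F} (hρ : IsConjugacy shift shift ρ)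
    {ψ : suspension F Y ≃ₜ θ.shiftSpace}
    (hψ : ∀ (z : suspension F Y), ∀ x ∈ baseSet θ (latticeOf H) x₀,
      blockMap H F x = ρ ⟨z.1.1, z.2⟩ → (ψ z : Config d 𝒜) = shift z.1.2 x) :
    IsConjugacy (suspAct H F) shift ψ := by
  rintro m ⟨⟨y, j⟩, hy⟩ hz
  obtain ⟨x, hx, e⟩ := (ρ ⟨y, hy⟩).2
  have hq : (j : Fin d → ℤ) + m - F.red (j + m) ∈ latticeOf H := F.sub_red_mem _
  rw [hψ ⟨(y, j), hy⟩ x hx e,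
    -- If `x` represents `y`, then `σ_{Hq} x` represents `σ_q y`, and `Hq + (j + m)_Γ = j + m`.
    hψ _ (shift (H.mulVec (latInv H ((j : Fin d → ℤ) + m - F.red (j + m)))) x)
      ((shift_mem_baseSet_iff hθ hx₀ hΓ hx _).2 (mulVec_mem_latticeOf _)) ?_]
  · rw [mulVec_latInv hH hq]
    simp only [suspAct]
    rw [shift_shift, shift_shift]
    congr 1
    abel
  · rw [blockMap_shift_mulVec, e]
    exact (hρ _ ⟨y, hy⟩ hz).symm

/-- Conjugacies carry extended symmetries to extended symmetries. -/
theorem IsConjugacy.exists_extendedSymmetry {Z Z' : Type*} [TopologicalSpace Z]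
    [TopologicalSpace Z'] {S : Set Z} {S' : Set Z'} {T : (Fin d → ℤ) → Z → Z}
    {T' : (Fin d → ℤ) → Z' → Z'} {ψ : S ≃ₜ S'} (hψ : IsConjugacy T T' ψ)
    (hT : ∀ n, ∀ z ∈ S, T n z ∈ S) {A : Matrix.GeneralLinearGroup (Fin d) ℤ} {Φ : S ≃ₜ S}
    (hΦ : IsExtendedSymmetry T A Φ) :
    ∃ Ψ : S' ≃ₜ S', IsExtendedSymmetry T' A Ψ ∧ ∀ z, Ψ (ψ z) = ψ (Φ z) := by
  refine ⟨(ψ.symm.trans Φ).trans ψ, fun n w hw => ?_, fun z => by simp⟩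
  obtain ⟨z, rfl⟩ := ψ.surjective w
  have h1 : (⟨T' n (ψ z), hw⟩ : S') = ψ ⟨T n z, hT n z z.2⟩ :=
    Subtype.ext (hψ n z (hT n z z.2)).symm
  have h2 : Φ ⟨T n z, hT n z z.2⟩ =
      ⟨T ((A : Matrix (Fin d) (Fin d) ℤ).mulVec n) (Φ z), hT _ _ (Φ z).2⟩ :=
    Subtype.ext (hΦ n z (hT n z z.2))
  simp only [h1, Homeomorph.trans_apply, Homeomorph.symm_apply_apply, h2]
  exact hψ _ _ _

theorem liftsToSuspension [Finite 𝒜] [DiscreteTopology 𝒜] [T2Space ℬ]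
    (hH : H.det ≠ 0) (hθ : θ.IsPrimitive) (hx₀ : x₀ ∈ θ.shiftSpace)
    (hΓ : returnModule x₀ ≤ latticeOf H) {A : Matrix.GeneralLinearGroup (Fin d) ℤ}
    (hA : H * (A : Matrix (Fin d) (Fin d) ℤ) = (A : Matrix (Fin d) (Fin d) ℤ) * H)
    {Y : Set (Config d ℬ)} (hY : ∀ n, ∀ y ∈ Y, shift n y ∈ Y)
    {ρ : Y ≃ₜ pureBase θ x₀ H F} (hρ : IsConjugacy shift shift ρ) :
    LiftsToSuspension θ x₀ H F A Y ρ := by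
  have : CompactSpace (pureBase θ x₀ H F) :=
    isCompact_iff_compactSpace.1 (isSubshift_pureBase hH F hθ hx₀ hΓ).1.isCompact
  -- Compactness of `Y` is inherited from `𝕐_0` through `ρ`.
  have hYc : IsCompact Y := isCompact_iff_compactSpace.2 ρ.symm.compactSpace
  refine ⟨fun n z hz => suspAct_mem_suspension F hY n hz, ?_⟩
  obtain ⟨ψ, hψ⟩ := exists_suspension_homeomorph hH hθ hx₀ hΓ hYc ρ
  have hconj := isConjugacy_suspension hH hθ hx₀ hΓ hρ hψ
  refine ⟨ψ, hψ, hconj, fun Φ hΦ i => ?_⟩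
  obtain ⟨Φi, hΦi⟩ := exists_liftHomeomorph F hYc hY hA i Φ
  have hsymm : IsExtendedSymmetry (suspAct H F) A Φi := by
    intro n z hz
    rw [hΦi, hΦi, liftMap_suspAct F hH hY hA i hΦ]
  exact ⟨Φi, hΦi, hsymm, hconj.exists_extendedSymmetry
    (fun n z hz => suspAct_mem_suspension F hY n hz) hsymm⟩

end Lifting

/-- Lifting of extended symmetries from the pure base of a block substitution `θ`, both for the
pure base `𝕐_0` itself and for every substitution shift `𝕏_ϑ` that is identified with it. -/
theorem mainTheorem10 {d : ℕ} {𝒜 : Type u} [Finite 𝒜] [TopologicalSpace 𝒜]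
    [DiscreteTopology 𝒜]
    (θ : DigitSubstitution d 𝒜) (hblock : θ.IsBlock) (hprim : θ.IsPrimitive)
    (haper : θ.IsAperiodic)
    (x₀ : Config d 𝒜) (hx₀ : x₀ ∈ θ.shiftSpace)
    (H : Matrix (Fin d) (Fin d) ℤ) (hH : H.det ≠ 0)
    (hheight : IsHeightLattice θ x₀ (latticeOf H))
    (F : FundDomain (latticeOf H))
    (A : Matrix.GeneralLinearGroup (Fin d) ℤ)
    (hA : (H.map (Int.cast : ℤ → ℚ))⁻¹ * (A : Matrix (Fin d) (Fin d) ℤ).map (Int.cast : ℤ → ℚ) =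
      (A : Matrix (Fin d) (Fin d) ℤ).map (Int.cast : ℤ → ℚ) * (H.map (Int.cast : ℤ → ℚ))⁻¹) :
    IsSubshift (pureBase θ x₀ H F) ∧
    LiftsToSuspension θ x₀ H F A (pureBase θ x₀ H F) (Homeomorph.refl _) ∧
    ∀ (ℬ : Type v) [Finite ℬ] [TopologicalSpace ℬ] [DiscreteTopology ℬ]
      (ϑ : DigitSubstitution d ℬ) (ρ : ϑ.shiftSpace ≃ₜ pureBase θ x₀ H F),
      IsConjugacy shift shift ρ →
        LiftsToSuspension θ x₀ H F A ϑ.shiftSpace ρ := by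
  have hA' := commute_of_inv_mul_eq hH hA
  have hΓ : returnModule x₀ ≤ latticeOf H := hheight.1.1
  have hsub := isSubshift_pureBase hH F hprim hx₀ hΓ
  refine ⟨hsub, liftsToSuspension hH hprim hx₀ hΓ hA' hsub.2 (fun _ _ _ => rfl), ?_⟩
  intro ℬ _ _ _ ϑ ρ hρ
  exact liftsToSuspension hH hprim hx₀ hΓ hA' (fun n y hy => ϑ.shift_mem_shiftSpace hy n) hρ
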